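/- A \emph{skew left brace} is a set $B$ with two group operations $\star$ and $\cdot$ such that $a\cdot(b\star c)=(a\cdot b)\star a^\star\star(a\cdot c)$ for all $a,b,c\in B$, where $a^\star$ is the inverse of $a$ for $\star$; the two groups have the same identity $1$. Put $\lambda_a(b)=a^\star\star(a\cdot b)$, let $G=(B,\star)\rtimes(B,\cdot)$ be the semidirect product with respect to $\lambda$, so that $(a,b)(a',b')=(a\star\lambda_b(a'),\,b\cdot b')$, and let $G$ act on $B$ by $\Theta_{(a,b)}(c)=a\star\lambda_b(c)\star a^\star$. Write $\operatorname{St}(a)$ for the stabiliser of $a$ under $\Theta$ and $\operatorname{core}_G(H)=\bigcap_{g\in G}gHg^{-1}$. Let $\mathcal O$ be the set of orbits of $\Theta$, and for each $i\in\mathcal O$ fix an element $a_i\in i$. A \emph{datum} consists of a non-empty subset $I\subseteq\mathcal O$ such that $\bigcup_{i\in I}i$ generates the group $(B,\star)$, and, for each $i\in I$, a non-empty set $J_i$ and a family $(K_{i,j})_{j\in J_i}$ of subgroups of $\operatorname{St}(a_i)$, such that $$\Bigl\{a\in B:\ (1,a),(a,a)\in\bigcap_{i\in I}\bigcap_{j\in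 J_i}\operatorname{core}_G(K_{i,j})\Bigr\}=\{1\}.$$ Its associated set-theoretic solution of the Yang--Baxter equation is $(X,r)$, where $X=\bigsqcup_{i\in I}\bigsqcup_{j\in J_i}G/K_{i,j}$ is the disjoint union of the sets of left cosets and $r(x,y)=(f_x(y),g_y(x))$, where for $x=(b_1,c_1)K_{i_1,j_1}$ and $y=(b_2,c_2)K_{i_2,j_2}$ $$f_x(y)=(1,\Theta_{(b_1,c_1)}(a_{i_1}))(b_2,c_2)K_{i_2,j_2},\qquad g_y(x)=(u,u)^{-1}(b_1,c_1)K_{i_1,j_1},\qquad u=\Theta_{(1,\Theta_{(b_1,c_1)}(a_{i_1}))}\Theta_{(b_2,c_2)}(a_{i_2}).$$ Solutions $(X,r)$ and $(X',r')$ are \emph{isomorphic} if there is a bijection $F\colon X\to X'$ with $r'\circ(F\times F)=(F\times F)\circ r$. \textbf{Theorem.} Let $B$ be a skew left brace with chosen elements $a_i\in i$ ($i\in\mathcal O$), let $(I,(J_i),(K_{i,j}))$ and $(I',(J'_{i'}),(L_{i',j'}))$ be two data, and let $(X,r)$ and $(X',r')$ be the associated solutions. Then $(X,r)$ and $(X',r')$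 are isomorphic if and only if there exist an automorphism $\psi$ of the skew left brace $B$, a bijection $\alpha\colon I\to I'$, bijections $\beta_i\colon J_i\to J'_{\alpha(i)}$ for each $i\in I$, and elements $y_{i,j},z_{i,j}\in B$ for each $i\in I$ and $j\in J_i$, such that $$\psi(a_i)=\Theta_{(y_{i,j},z_{i,j})}(a_{\alpha(i)})\quad\text{and}\quad(\psi\times\psi)(K_{i,j})=(y_{i,j},z_{i,j})\,L_{\alpha(i),\beta_i(j)}\,(y_{i,j},z_{i,j})^{-1}$$ for all $i\in I$ and $j\in J_i$. -/

import Mathlib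

universe u v w

/-- A skew left brace. The star operation `⋆` is written additively (the additive group is *not*
assumed commutative): `a ⋆ b` is `a + b` and the star inverse of `a` is `-a`. The operation `·`
is written multiplicatively. -/
class SkewLeftBrace (B : Type*) extends Group B, AddGroup B where
  mul_add_eq : ∀ a b c : B, a * (b + c) = a * b + -a + a * c

namespace SkewLeftBrace

section Brace

variable {B : Type*} [SkewLeftBrace B]

theorem mul_zero_eq (a : B) : a * 0 = a := by
  have h := mul_add_eq a 0 0
  rw [add_zero, add_assoc] at h
  have h2 : -a + a * 0 = 0 := by simpa using h
  exact (neg_add_eq_zero.mp h2).symm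

theorem zero_eq_one : (0 : B) = 1 := by
  have h := mul_zero_eq (1 : B)
  rwa [one_mul] at h

/-- The map `λ_a(b) = a^⋆ ⋆ (a · b)`. -/
def lam (a b : B) : B := -a + a * b

theorem mul_eq_add_lam (a b : B) : a * b = a + lam a b := by simp [lam]

theorem lam_add (a b c : B) : lam a (b + c) = lam a b + lam a c := by
  simp [lam, mul_add_eq, add_assoc]

theorem lam_one (b : B) : lam 1 b = b := by
  rw [lam, one_mul, ← zero_eq_one, neg_zero, zero_add]

theorem lam_zero (a : B) : lam a 0 = 0 := by
  simp [lam, mul_zero_eq]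

theorem lam_neg (a b : B) : lam a (-b) = -lam a b := by
  apply eq_neg_of_add_eq_zero_left
  rw [← lam_add, neg_add_cancel, lam_zero]

theorem lam_mul (a b c : B) : lam (a * b) c = lam a (lam b c) := by
  have h : lam a (lam b c) = -(lam a b) + lam a (b * c) := by
    rw [← lam_neg, ← lam_add]; rfl
  rw [h]
  simp [lam, mul_assoc, add_assoc]

variable (B) in
/-- The action `λ : (B, ·) → Aut(B, ⋆)` as a morphism of groups. -/
def lamHom : B →* MulAut (Multiplicative B) where
  toFun a :=
    { toFun := fun b => Multiplicative.ofAdd (lam a b.toAdd)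
      invFun := fun b => Multiplicative.ofAdd (lam a⁻¹ b.toAdd)
      left_inv := fun b => by simp [← lam_mul, lam_one]
      right_inv := fun b => by simp [← lam_mul, lam_one]
      map_mul' := fun b c => by simp [lam_add] }
  map_one' := by ext b; simp [lam_one]
  map_mul' a b := by ext c; simp [lam_mul]

variable (B) in
/-- The semidirect product `G = (B, ⋆) ⋊ (B, ·)` with respect to `λ`. -/
abbrev Semi : Type _ := Multiplicative B ⋊[lamHom B] B

/-- The element `(a, b)` of `(B, ⋆) ⋊ (B, ·)`. -/
def pair (a b : B) : Semi B := ⟨Multiplicative.ofAdd a, b⟩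

theorem pair_mul (a b c d : B) : pair a b * pair c d = pair (a + lam b c) (b * d) := rfl

theorem one_eq_pair : (1 : Semi B) = pair 1 1 := by
  change (⟨Multiplicative.ofAdd 0, 1⟩ : Semi B) = pair 1 1
  rw [zero_eq_one]; rfl

/-- The map `Θ_{(a,b)}(c) = a ⋆ λ_b(c) ⋆ a^⋆`. -/
def Theta (g : Semi B) (c : B) : B := g.left.toAdd + lam g.right c + -g.left.toAdd

theorem Theta_pair (a b c : B) : Theta (pair a b) c = a + lam b c + -a := rfl

/-- The action `Θ` of `(B, ⋆) ⋊ (B, ·)` on `B`. -/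
instance : MulAction (Semi B) B where
  smul g c := Theta g c
  one_smul c := by
    change Theta 1 c = c
    rw [one_eq_pair, Theta_pair, lam_one, ← zero_eq_one]; simp
  mul_smul g h c := by
    change Theta (pair g.left.toAdd g.right * pair h.left.toAdd h.right) c =
      Theta (pair g.left.toAdd g.right)
      (Theta (pair h.left.toAdd h.right) c)
    rw [pair_mul]
    simp only [Theta_pair, lam_mul, lam_add, lam_neg, neg_add_rev, add_assoc]

theorem smul_eq_Theta (g : Semi B) (c : B) : g • c = Theta g c := rfl

variable (B) in
/-- The set `𝒪` of orbits of `B` under the action `Θ`. -/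
abbrev Orbits : Type _ := MulAction.orbitRel.Quotient (Semi B) B

/-- The map `ψ × ψ` on `(B, ⋆) ⋊ (B, ·)`. -/
def prodMap (ψ : B → B) (g : Semi B) : Semi B := pair (ψ g.left.toAdd) (ψ g.right)

end Brace

/-- A set-theoretic solution `(X, r)` of the Yang-Baxter equation. -/
structure Solution (X : Type*) where
  r : X × X → X × X
  nonempty : Nonempty X
  bijective : Function.Bijective r
  /-- `r₁ r₂ r₁ = r₂ r₁ r₂`, with `r₁ = r × id` and `r₂ = id × r` on `X × X × X`. -/
  braid :
    let r₁ : X × X × X → X × X × X := fun p =>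
      ((r (p.1, p.2.1)).1, (r (p.1, p.2.1)).2, p.2.2)
    let r₂ : X × X × X → X × X × X := fun p => (p.1, r p.2)
    r₁ ∘ r₂ ∘ r₁ = r₂ ∘ r₁ ∘ r₂

/-- Two solutions are isomorphic if there is a bijective morphism of solutions between them. -/
def Solution.Isomorphic {X Y : Type*} (S : Solution X) (T : Solution Y) : Prop :=
  ∃ F : X → Y, Function.Bijective F ∧
    ∀ x₁ x₂ : X, T.r (F x₁, F x₂) = Prod.map F F (S.r (x₁, x₂))

/-- The data `(I, (J_i), (K_{i,j}))`, relative to a choice `a` of elements of `B` indexed by the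
orbits of `Θ`, from which a solution is constructed. -/
structure SolutionData (B : Type u) [SkewLeftBrace B] (a : Orbits B → B) where
  I : Set (Orbits B)
  /-- automatic as soon as `B` has more than one element -/
  I_nonempty : I.Nonempty
  /-- the union of the orbits in `I` generates `(B, ⋆)` -/
  generates : AddSubgroup.closure (⋃ i ∈ I, i.orbit) = ⊤
  J : I → Type v
  J_nonempty : ∀ i, Nonempty (J i)
  K : (i : I) → J i → Subgroup (Semi B)
  K_le : ∀ i j, K i j ≤ MulAction.stabilizer (Semi B) (a i)
  core : {b : B | pair 1 b ∈ ⨅ i, ⨅ j, (K i j).normalCore ∧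
    pair b b ∈ ⨅ i, ⨅ j, (K i j).normalCore} = {1}

namespace SolutionData

variable {B : Type u} [SkewLeftBrace B] {a : Orbits B → B} (D : SolutionData.{u, v} B a)

/-- `X`, the disjoint union over `i ∈ I`, `j ∈ J_i` of the sets of left cosets `G / K_{i,j}`;
`G` acts on it by left multiplication. -/
abbrev X : Type _ := Σ i : D.I, Σ j : D.J i, Semi B ⧸ D.K i j

/-- The map `η : X → B`, `(b,c) K_{i,j} ↦ Θ_{(b,c)}(a_i)`. -/
def eta (x : D.X) : B :=
  Quotient.liftOn' x.2.2 (fun g => Theta g (a x.1)) (by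
    intro g h hgh
    have h1 := D.K_le _ _ (QuotientGroup.leftRel_apply.mp hgh)
    rw [MulAction.mem_stabilizer_iff, mul_smul, inv_smul_eq_iff] at h1
    exact h1.symm)

theorem eta_mk (i : D.I) (j : D.J i) (g : Semi B) :
    D.eta ⟨i, j, (g : Semi B ⧸ D.K i j)⟩ = Theta g (a i) := rfl

theorem eta_smul (g : Semi B) (x : D.X) : D.eta (g • x) = g • D.eta x := by
  obtain ⟨i, j, q⟩ := x
  induction q using QuotientGroup.induction_on with
  | H h => exact mul_smul g h (a i)

/-- `f_x(y) = (1, η(x)) · y`. -/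
def f (x y : D.X) : D.X := pair 1 (D.eta x) • y

/-- `g_y(x) = (u, u)⁻¹ · x` where `u = Θ_{(1, η(x))}(η(y))`. -/
def g (y x : D.X) : D.X :=
  (pair (Theta (pair 1 (D.eta x)) (D.eta y)) (Theta (pair 1 (D.eta x)) (D.eta y)))⁻¹ • x

theorem f_mk (i₁ i₂ : D.I) (j₁ : D.J i₁) (j₂ : D.J i₂) (g₁ g₂ : Semi B) :
    D.f ⟨i₁, j₁, (g₁ : Semi B ⧸ D.K i₁ j₁)⟩ ⟨i₂, j₂, (g₂ : Semi B ⧸ D.K i₂ j₂)⟩ =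
      ⟨i₂, j₂, ((pair 1 (Theta g₁ (a i₁)) * g₂ : Semi B) : Semi B ⧸ D.K i₂ j₂)⟩ := rfl

theorem g_mk (i₁ i₂ : D.I) (j₁ : D.J i₁) (j₂ : D.J i₂) (g₁ g₂ : Semi B) :
    D.g ⟨i₂, j₂, (g₂ : Semi B ⧸ D.K i₂ j₂)⟩ ⟨i₁, j₁, (g₁ : Semi B ⧸ D.K i₁ j₁)⟩ =
      ⟨i₁, j₁, (((pair (Theta (pair 1 (Theta g₁ (a i₁))) (Theta g₂ (a i₂)))
        (Theta (pair 1 (Theta g₁ (a i₁))) (Theta g₂ (a i₂))))⁻¹ * g₁ : Semi B) :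
          Semi B ⧸ D.K i₁ j₁)⟩ := rfl

theorem g_eq (y x : D.X) :
    D.g y x = (pair (D.eta (D.f x y)) (D.eta (D.f x y)))⁻¹ • x := by
  rw [f, eta_smul]; rfl

theorem eta_f (x y : D.X) : D.eta (D.f x y) = lam (D.eta x) (D.eta y) := by
  rw [f, eta_smul, smul_eq_Theta, Theta_pair, ← zero_eq_one]; simp

theorem eta_f_mul_eta_g (x y : D.X) :
    D.eta (D.f x y) * D.eta (D.g y x) = D.eta x * D.eta y := by
  have h : pair (D.eta (D.f x y)) (D.eta (D.f x y)) • D.eta (D.g y x) = D.eta x := by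
    rw [g_eq, eta_smul, smul_inv_smul]
  rw [smul_eq_Theta, Theta_pair, ← mul_eq_add_lam] at h
  rw [mul_eq_add_lam (D.eta x), ← eta_f, ← h]
  simp

theorem pair_diag_mul (b c : B) : pair b b * pair c c = pair (b * c) (b * c) := by
  rw [pair_mul, ← mul_eq_add_lam]

theorem pair_one_mul (b c : B) : pair 1 b * pair 1 c = pair 1 (b * c) := by
  rw [pair_mul, ← zero_eq_one, lam_zero, zero_add]

/-- The map `r(x, y) = (f_x(y), g_y(x))`. -/
def rMap (p : D.X × D.X) : D.X × D.X := (D.f p.1 p.2, D.g p.2 p.1)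

theorem rMap_bijective : Function.Bijective D.rMap := by
  constructor
  · rintro ⟨x, y⟩ ⟨x', y'⟩ h
    obtain ⟨h1, h2⟩ := Prod.mk.inj h
    simp only at h1 h2
    rw [g_eq, g_eq, h1] at h2
    have hx : x = x' := smul_left_cancel _ h2
    subst hx
    rw [smul_left_cancel _ h1]
  · rintro ⟨u, v⟩
    refine ⟨(pair (D.eta u) (D.eta u) • v,
      (pair 1 (D.eta (pair (D.eta u) (D.eta u) • v)))⁻¹ • u), ?_⟩
    have h1 : D.f (pair (D.eta u) (D.eta u) • v)
        ((pair 1 (D.eta (pair (D.eta u) (D.eta u) • v)))⁻¹ • u) = u := by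
      rw [f, smul_inv_smul]
    simp only [rMap, g_eq, h1, inv_smul_smul]

theorem f_f (x y z : D.X) : D.f (D.f x y) (D.f (D.g y x) z) = D.f x (D.f y z) := by
  simp only [f, ← mul_smul, pair_one_mul]
  have := D.eta_f_mul_eta_g x y
  rw [f] at this
  rw [this]

theorem f_g (x y z : D.X) :
    D.g (D.f (D.g y x) z) (D.f x y) = D.f (D.g (D.f y z) x) (D.g z y) := by
  have hC := D.eta_f_mul_eta_g x (D.f y z)
  have hS := D.eta_f x (D.f y z)
  rw [D.g_eq _ (D.f x y), f_f, inv_smul_eq_iff, D.g_eq z y]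
  generalize D.eta (D.f x (D.f y z)) = S at *
  generalize D.eta (D.f y z) = P at *
  generalize hw : D.g (D.f y z) x = w at *
  rw [f, f, smul_smul, smul_smul]
  congr 1
  rw [eq_mul_inv_iff_mul_eq, pair_mul, pair_mul, hC, ← hS, ← zero_eq_one, lam_zero,
    zero_add, add_zero]

theorem g_g (x y z : D.X) :
    D.g z (D.g y x) = D.g (D.g z y) (D.g (D.f y z) x) := by
  have h1 := D.eta_f_mul_eta_g (D.f x y) (D.f (D.g y x) z)
  rw [f_f, f_g] at h1
  rw [D.g_eq z, D.g_eq (D.g z y)]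
  have h2 := D.g_eq y x
  have h3 := D.g_eq (D.f y z) x
  generalize D.eta (D.f (D.g y x) z) = A at *
  generalize D.eta (D.f (D.g (D.f y z) x) (D.g z y)) = C at *
  rw [h2, h3, smul_smul, smul_smul, ← mul_inv_rev, ← mul_inv_rev, pair_diag_mul,
    pair_diag_mul, h1]

/-- The solution `(X, r)` constructed from the data. -/
def solution : Solution D.X where
  r := D.rMap
  nonempty := by
    obtain ⟨i, hi⟩ := D.I_nonempty
    obtain ⟨j⟩ := D.J_nonempty ⟨i, hi⟩
    exact ⟨⟨⟨i, hi⟩, j, ((1 : Semi B) : Semi B ⧸ D.K ⟨i, hi⟩ j)⟩⟩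
  bijective := D.rMap_bijective
  braid := by
    funext p
    obtain ⟨x, y, z⟩ := p
    exact Prod.ext (D.f_f x y z) (Prod.ext (D.f_g x y z) (D.g_g x y z))

end SolutionData

end SkewLeftBrace

namespace SkewLeftBrace

/-! ### Passing between the two group structures of a skew left brace -/

section Brace

variable {B : Type*} [SkewLeftBrace B]

/-! The solution determines how `(1, η(x))` and `(η(x), η(x))` act on `X`: the first acts as `f_x`,
and the inverse of the second is recovered from the maps `g`. An isomorphism `F` therefore carries
these two actions to those of `η'(F x)` (`intertwines_eta`). The relation `Intertwines F b b'` is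
multiplicative, and by the core condition it is single-valued in both directions. Since `η(X)` is
stable under `λ` and generates `(B, ⋆)`, it also generates `(B, ·)`, so the relation is the graph of
a multiplicative bijection `ψ` with `η' ∘ F = ψ ∘ η`. Equivariance of `η` makes `ψ` commute with `λ`
on `η(X)`, which forces additivity. As `(b, c) = (b, b)(1, b⁻¹c)`, the map `F` is equivariant along
`ψ × ψ` (`exists_ringEquiv`).

What remains is the classification of `G`-sets: a `ψ × ψ`-equivariant bijection permutes the orbits
`G/K_{i,j}` and conjugates the stabilisers, while `η` keeps track of `i` (`exists_map_coset`).
Conversely, `gK ↦ (ψ × ψ)(g)γL` is such a bijection and respects `η`, hence `r`. -/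

theorem Theta_pair_one (b c : B) : Theta (pair 1 b) c = lam b c := by
  rw [Theta_pair, ← zero_eq_one]; simp

theorem pair_one_smul (b c : B) : pair 1 b • c = lam b c := Theta_pair_one b c

theorem pair_eq_diag_mul (b c : B) : pair b c = pair b b * pair 1 (b⁻¹ * c) := by
  rw [pair_mul, ← zero_eq_one, lam_zero, add_zero, mul_inv_cancel_left]

theorem pair_one_inv (b : B) : (pair 1 b)⁻¹ = pair 1 b⁻¹ := by
  rw [inv_eq_iff_mul_eq_one, SolutionData.pair_one_mul, mul_inv_cancel, one_eq_pair]

theorem pair_diag_inv (b : B) : (pair b b)⁻¹ = pair b⁻¹ b⁻¹ := by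
  rw [inv_eq_iff_mul_eq_one, SolutionData.pair_diag_mul, mul_inv_cancel, one_eq_pair]

theorem add_eq_mul_lam_inv (b c : B) : b + c = b * lam b⁻¹ c := by
  rw [mul_eq_add_lam, ← lam_mul, mul_inv_cancel, lam_one]

/-- Expand `(-c)⁻¹ * (-c) = 1` through `λ`. Thus `-c` is the multiplicative inverse of a
`λ`-translate of `c`, which handles negatives of generators. -/
theorem lam_neg_inv_self (c : B) : lam (-c)⁻¹ c = (-c)⁻¹ := by
  have h := mul_eq_add_lam (-c)⁻¹ (-c)
  rw [inv_mul_cancel, lam_neg, ← zero_eq_one, ← sub_eq_add_neg] at h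
  exact (sub_eq_zero.mp h.symm).symm

/-- A subset of a skew left brace which is stable under `λ` and generates the additive group also
generates the multiplicative group. -/
theorem closure_eq_top_of_lam_mem {S : Set B} (hS : ∀ b, ∀ s ∈ S, lam b s ∈ S)
    (hgen : AddSubgroup.closure S = ⊤) : Subgroup.closure S = ⊤ := by
  refine (Subgroup.eq_top_iff' _).mpr fun b => ?_
  have hb : b ∈ AddSubgroup.closure S := by rw [hgen]; trivial
  induction hb using AddSubgroup.closure_induction_right with
  | zero => rw [zero_eq_one]; exact one_mem _
  | add_right c _ s hs ih =>
    rw [add_eq_mul_lam_inv]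
    exact mul_mem ih (Subgroup.subset_closure (hS _ _ hs))
  | add_neg_cancel c _ s hs ih =>
    rw [add_eq_mul_lam_inv, lam_neg]
    refine mul_mem ih ?_
    rw [← inv_inv (-lam c⁻¹ s), ← lam_neg_inv_self]
    exact inv_mem (Subgroup.subset_closure (hS _ _ (hS _ _ hs)))

/-- A multiplicative map which commutes with `λ` on a `λ`-stable additive generating set is
additive. -/
theorem map_add_of_map_lam {S : Set B} (hS : ∀ b, ∀ s ∈ S, lam b s ∈ S)
    (hgen : AddSubgroup.closure S = ⊤) (ψ : B →* B)
    (hψ : ∀ b, ∀ s ∈ S, ψ (lam b s) = lam (ψ b) (ψ s)) (b c : B) :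
    ψ (b + c) = ψ b + ψ c := by
  -- Write `b + s = b * s'` with `s' = lam b⁻¹ s`, again in `S`; the `λ`-compatibility then applies
  -- to `s'`.
  have key : ∀ b, ∀ s ∈ S, ψ (b + s) = ψ b + ψ s := fun b s hs => by
    rw [add_eq_mul_lam_inv, map_mul, mul_eq_add_lam, ← hψ _ _ (hS _ _ hs), ← lam_mul,
      mul_inv_cancel, lam_one]
  have key' : ∀ b, ∀ s ∈ S, ψ (b + -s) = ψ b + -ψ s := fun b s hs => by
    rw [eq_add_neg_iff_add_eq, ← key _ _ hs, neg_add_cancel_right]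
  have hc : c ∈ AddSubgroup.closure S := by rw [hgen]; trivial
  induction hc using AddSubgroup.closure_induction_right generalizing b with
  | zero => rw [add_zero, zero_eq_one, map_one, ← zero_eq_one, add_zero]
  | add_right c _ s hs ih => rw [← add_assoc, key _ _ hs, key _ _ hs, ih, add_assoc]
  | add_neg_cancel c _ s hs ih => rw [← add_assoc, key' _ _ hs, key' _ _ hs, ih, add_assoc]

theorem map_lam (ψ : B ≃+* B) (b c : B) : ψ (lam b c) = lam (ψ b) (ψ c) := by
  simp [lam]

/-- The automorphism `ψ × ψ` of `(B, ⋆) ⋊ (B, ·)` induced by an automorphism `ψ` of `B`. -/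
def prodEquiv (ψ : B ≃+* B) : Semi B ≃* Semi B where
  toFun := prodMap ψ
  invFun := prodMap ψ.symm
  left_inv g := by simp [prodMap, pair]
  right_inv g := by simp [prodMap, pair]
  map_mul' g h := by
    change pair (ψ (g.left.toAdd + lam g.right h.left.toAdd)) (ψ (g.right * h.right)) = _
    rw [map_add, map_lam, map_mul]; rfl

theorem prodEquiv_pair (ψ : B ≃+* B) (b c : B) : prodEquiv ψ (pair b c) = pair (ψ b) (ψ c) := rfl

theorem map_smul_eq_prodEquiv_smul (ψ : B ≃+* B) (g : Semi B) (c : B) :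
    ψ (g • c) = prodEquiv ψ g • ψ c := by
  change ψ (g.left.toAdd + lam g.right c + -g.left.toAdd) = _
  rw [map_add, map_add, map_lam, map_neg]; rfl

/-- The pointwise form is what a comparison of equalities of cosets produces. -/
theorem image_prodMap_eq_conj_iff (ψ : B ≃+* B) (γ : Semi B) (K L : Subgroup (Semi B)) :
    prodMap ψ '' (K : Set (Semi B)) = (fun l => γ * l * γ⁻¹) '' (L : Set (Semi B)) ↔
      ∀ k, k ∈ K ↔ γ⁻¹ * prodEquiv ψ k * γ ∈ L := by
  have hK : prodMap ψ '' (K : Set (Semi B)) = K.map (prodEquiv ψ).toMonoidHom := rfl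
  have hL : (fun l => γ * l * γ⁻¹) '' (L : Set (Semi B)) =
      L.map (MulAut.conj γ).toMonoidHom := rfl
  rw [hK, hL, SetLike.coe_set_eq, SetLike.ext_iff, (prodEquiv ψ).surjective.forall]
  simp only [Subgroup.mem_map_equiv, MulEquiv.symm_apply_apply, MulAut.conj_symm_apply]

theorem orbit_eq {a : Orbits B → B} (ha : ∀ i : Orbits B, a i ∈ i.orbit) (i : Orbits B) :
    i.orbit = MulAction.orbit (Semi B) (a i) := by
  conv_lhs => rw [← MulAction.orbitRel.Quotient.mem_orbit.mp (ha i)]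
  exact MulAction.orbitRel.Quotient.orbit_mk _

theorem eq_of_mem_orbit {a : Orbits B → B} (ha : ∀ i : Orbits B, a i ∈ i.orbit) {i k : Orbits B}
    (h : a i ∈ MulAction.orbit (Semi B) (a k)) : i = k := by
  rw [← MulAction.orbitRel.Quotient.orbit_inj, orbit_eq ha, orbit_eq ha, MulAction.orbit_eq_iff]
  exact h

end Brace

namespace SolutionData

variable {B : Type u} [SkewLeftBrace B] {a : Orbits B → B}

/-! ### The action of `G` on `X` and the map `η` -/

section

variable (D : SolutionData.{u, v} B a)

/-- The coset `g K_{i,j}` as an element of `X`. -/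
def coset (i : D.I) (j : D.J i) (g : Semi B) : D.X := ⟨i, j, (g : Semi B ⧸ D.K i j)⟩

theorem exists_eq_coset (x : D.X) : ∃ i j g, x = D.coset i j g := by
  obtain ⟨i, j, q⟩ := x
  induction q using QuotientGroup.induction_on with
  | H g => exact ⟨i, j, g, rfl⟩

theorem smul_coset (i : D.I) (j : D.J i) (g h : Semi B) :
    g • D.coset i j h = D.coset i j (g * h) := rfl

theorem coset_eq_coset_iff {i : D.I} {j : D.J i} {g h : Semi B} :
    D.coset i j g = D.coset i j h ↔ g⁻¹ * h ∈ D.K i j := by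
  rw [← QuotientGroup.eq]
  exact ((sigma_mk_injective (i := i)).comp (sigma_mk_injective (i := j))).eq_iff

theorem eq_of_coset_eq_coset {i : D.I} {j j' : D.J i} {g h : Semi B}
    (e : D.coset i j g = D.coset i j' h) : j = j' :=
  congrArg Sigma.fst (eq_of_heq (Sigma.mk.inj e).2)

theorem eta_coset (i : D.I) (j : D.J i) (g : Semi B) : D.eta (D.coset i j g) = g • a i := rfl

theorem mem_normalCore_of_smul_eq {g : Semi B} (h : ∀ x : D.X, g • x = x) :
    g ∈ ⨅ i, ⨅ j, (D.K i j).normalCore := by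
  simp only [Subgroup.mem_iInf]
  intro i j k
  -- Fixing the coset `k⁻¹K` means `k * g * k⁻¹ ∈ K`.
  have := h (D.coset i j k⁻¹)
  rw [smul_coset, eq_comm, coset_eq_coset_iff, inv_inv, ← mul_assoc] at this
  exact this

/-- The core condition, read as a faithfulness statement about the action on `X`. -/
theorem eq_one_of_smul_eq {b : B} (h₁ : ∀ x : D.X, pair 1 b • x = x)
    (h₂ : ∀ x : D.X, pair b b • x = x) : b = 1 := by
  have : b ∈ ({1} : Set B) := by
    rw [← D.core]
    exact ⟨D.mem_normalCore_of_smul_eq h₁, D.mem_normalCore_of_smul_eq h₂⟩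
  exact this

theorem lam_mem_range_eta (b : B) : ∀ s ∈ Set.range D.eta, lam b s ∈ Set.range D.eta := by
  rintro _ ⟨x, rfl⟩
  exact ⟨pair 1 b • x, by rw [eta_smul, pair_one_smul]⟩

theorem closure_range_eta (ha : ∀ i : Orbits B, a i ∈ i.orbit) :
    AddSubgroup.closure (Set.range D.eta) = ⊤ := by
  rw [eq_top_iff, ← D.generates]
  refine AddSubgroup.closure_mono (Set.iUnion₂_subset fun i hi b hb => ?_)
  obtain ⟨j⟩ := D.J_nonempty ⟨i, hi⟩
  rw [orbit_eq ha] at hb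
  obtain ⟨g, rfl⟩ := hb
  exact ⟨D.coset ⟨i, hi⟩ j g, rfl⟩

end

/-! ### From an isomorphism of solutions to an automorphism of `B`, and back -/

variable {D : SolutionData.{u, v} B a} {D' : SolutionData.{u, w} B a}

/-- The bijection `F` carries the actions of `(1, b)` and `(b, b)` on `X` to those of `(1, b')`
and `(b', b')` on `X'`. -/
def Intertwines (F : D.X ≃ D'.X) (b b' : B) : Prop :=
  (∀ x, F (pair 1 b • x) = pair 1 b' • F x) ∧ ∀ x, F (pair b b • x) = pair b' b' • F x

namespace Intertwines

variable {F : D.X ≃ D'.X} {b b' c c' : B}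

theorem symm (h : Intertwines F b b') : Intertwines F.symm b' b :=
  ⟨fun x => by rw [Equiv.symm_apply_eq, h.1, F.apply_symm_apply],
    fun x => by rw [Equiv.symm_apply_eq, h.2, F.apply_symm_apply]⟩

theorem one : Intertwines F 1 1 := by
  constructor <;> intro x <;> rw [← one_eq_pair, one_smul, one_smul]

theorem mul (h : Intertwines F b b') (k : Intertwines F c c') :
    Intertwines F (b * c) (b' * c') := by
  constructor <;> intro x
  · rw [← pair_one_mul, ← pair_one_mul, mul_smul, mul_smul, h.1, k.1]
  · rw [← pair_diag_mul, ← pair_diag_mul, mul_smul, mul_smul, h.2, k.2]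

theorem inv (h : Intertwines F b b') : Intertwines F b⁻¹ b'⁻¹ := by
  constructor <;> intro x
  · rw [← pair_one_inv, ← pair_one_inv, eq_inv_smul_iff, ← h.1, smul_inv_smul]
  · rw [← pair_diag_inv, ← pair_diag_inv, eq_inv_smul_iff, ← h.2, smul_inv_smul]

theorem eq_one (h : Intertwines F 1 b') : b' = 1 := by
  refine D'.eq_one_of_smul_eq (fun x => ?_) fun x => ?_
  · obtain ⟨x, rfl⟩ := F.surjective x
    rw [← h.1, ← one_eq_pair, one_smul]
  · obtain ⟨x, rfl⟩ := F.surjective x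
    rw [← h.2, ← one_eq_pair, one_smul]

theorem unique (h : Intertwines F b b') (k : Intertwines F b c') : b' = c' := by
  have := h.mul k.inv
  rw [mul_inv_cancel] at this
  exact mul_inv_eq_one.mp this.eq_one

/-- The elements having a partner form a subgroup of `(B, ·)` containing the generating set `η(X)`.
-/
theorem exists_right (ha : ∀ i : Orbits B, a i ∈ i.orbit)
    (hF : ∀ x, Intertwines F (D.eta x) (D'.eta (F x))) (b : B) : ∃ b', Intertwines F b b' := by
  have hb : b ∈ Subgroup.closure (Set.range D.eta) := by
    rw [closure_eq_top_of_lam_mem D.lam_mem_range_eta (D.closure_range_eta ha)]; trivial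
  induction hb using Subgroup.closure_induction with
  | mem _ h => obtain ⟨x, rfl⟩ := h; exact ⟨_, hF x⟩
  | one => exact ⟨1, one⟩
  | mul _ _ _ _ h k =>
    obtain ⟨_, h⟩ := h
    obtain ⟨_, k⟩ := k
    exact ⟨_, h.mul k⟩
  | inv _ _ h => obtain ⟨_, h⟩ := h; exact ⟨_, h.inv⟩

end Intertwines

/-- An isomorphism of solutions intertwines the elements of `B` attached to corresponding
points. -/
theorem intertwines_eta (F : D.X ≃ D'.X)
    (hF : ∀ x y, D'.solution.r (F x, F y) = Prod.map F F (D.solution.r (x, y))) (x : D.X) :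
    Intertwines F (D.eta x) (D'.eta (F x)) := by
  have hf : ∀ x y, D'.f (F x) (F y) = F (D.f x y) := fun x y => congrArg Prod.fst (hF x y)
  have hg : ∀ x y, D'.g (F y) (F x) = F (D.g y x) := fun x y => congrArg Prod.snd (hF x y)
  refine ⟨fun y => (hf x y).symm, fun z => ?_⟩
  have key : ∀ t, F ((pair (D.eta x) (D.eta x))⁻¹ • t) =
      (pair (D'.eta (F x)) (D'.eta (F x)))⁻¹ • F t := fun t => by
    -- The second argument is the `y` with `f_t(y) = x`, so that `g_y(t) = (η(x), η(x))⁻¹ • t`.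
    have h := hg t ((pair 1 (D.eta t))⁻¹ • x)
    rw [g_eq, g_eq, hf, f, smul_inv_smul] at h
    exact h.symm
  rw [← inv_smul_eq_iff, ← key, inv_smul_smul]

/-- An isomorphism of solutions comes from an automorphism of the skew left brace. -/
theorem exists_ringEquiv (ha : ∀ i : Orbits B, a i ∈ i.orbit) (F : D.X ≃ D'.X)
    (hF : ∀ x y, D'.solution.r (F x, F y) = Prod.map F F (D.solution.r (x, y))) :
    ∃ ψ : B ≃+* B, (∀ x, D'.eta (F x) = ψ (D.eta x)) ∧
      ∀ g x, F (g • x) = prodEquiv ψ g • F x := by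
  have hη := intertwines_eta F hF
  have hη' : ∀ x, Intertwines F.symm (D'.eta x) (D.eta (F.symm x)) := fun x => by
    simpa using (hη (F.symm x)).symm
  choose φ hφ using Intertwines.exists_right ha hη
  -- The same construction for `F.symm`; uniqueness of partners makes `χ` inverse to `φ`.
  choose χ hχ using Intertwines.exists_right ha hη'
  let ψ : B →* B :=
    { toFun := φ
      map_one' := (hφ 1).unique Intertwines.one
      map_mul' := fun b c => (hφ _).unique ((hφ b).mul (hφ c)) }
  have hψη : ∀ x, D'.eta (F x) = ψ (D.eta x) := fun x => (hη x).unique (hφ _)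
  have hadd := map_add_of_map_lam D.lam_mem_range_eta (D.closure_range_eta ha) ψ (by
    rintro b _ ⟨x, rfl⟩
    rw [← pair_one_smul, ← eta_smul, ← hψη, (hφ b).1, eta_smul, pair_one_smul, hψη]; rfl)
  let ψ' : B ≃+* B :=
    { toFun := φ
      invFun := χ
      left_inv := fun b => (hχ _).unique (hφ b).symm
      right_inv := fun b => (hφ _).unique (hχ b).symm
      map_mul' := ψ.map_mul
      map_add' := hadd }
  refine ⟨ψ', hψη, fun g x => ?_⟩
  obtain ⟨b, c, rfl⟩ : ∃ b c, g = pair b c := ⟨_, _, rfl⟩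
  rw [pair_eq_diag_mul, map_mul, mul_smul, mul_smul, (hφ _).2, (hφ _).1, prodEquiv_pair,
    prodEquiv_pair, map_one]
  rfl

/-- A bijection compatible with an automorphism of the skew left brace is an isomorphism of
solutions. -/
theorem isomorphic_of_equivariant (F : D.X → D'.X) (hbij : Function.Bijective F) (ψ : B ≃+* B)
    (hη : ∀ x, D'.eta (F x) = ψ (D.eta x)) (hF : ∀ g x, F (g • x) = prodEquiv ψ g • F x) :
    D.solution.Isomorphic D'.solution := by
  have hf : ∀ x y, D'.f (F x) (F y) = F (D.f x y) := fun x y => by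
    rw [f, f, hF, hη, prodEquiv_pair, map_one]
  refine ⟨F, hbij, fun x y => Prod.ext (hf x y) ?_⟩
  change D'.g (F y) (F x) = F (D.g y x)
  rw [g_eq, g_eq, hF, hf, hη, map_inv, prodEquiv_pair]

/-! ### Equivariant bijections between disjoint unions of coset spaces -/

theorem map_coset_bijective {ψ : B ≃+* B} {α : D.I → D'.I} {β : (i : D.I) → D.J i → D'.J (α i)}
    {γ : (i : D.I) → D.J i → Semi B} {F : D.X → D'.X}
    (hF : ∀ i j g, F (D.coset i j g) = D'.coset (α i) (β i j) (prodEquiv ψ g * γ i j))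
    (hα : Function.Bijective α) (hβ : ∀ i, Function.Bijective (β i))
    (hK : ∀ i j k, k ∈ D.K i j ↔ (γ i j)⁻¹ * prodEquiv ψ k * γ i j ∈ D'.K (α i) (β i j)) :
    Function.Bijective F := by
  constructor
  · intro x x' h
    obtain ⟨i, j, g, rfl⟩ := D.exists_eq_coset x
    obtain ⟨i', j', g', rfl⟩ := D.exists_eq_coset x'
    rw [hF, hF] at h
    obtain rfl := hα.1 (congrArg Sigma.fst h)
    obtain rfl := (hβ i).1 (D'.eq_of_coset_eq_coset h)
    rw [coset_eq_coset_iff] at h ⊢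
    rw [hK, map_mul, map_inv]
    simpa [mul_assoc] using h
  · intro x
    obtain ⟨i, j, g, rfl⟩ := D'.exists_eq_coset x
    obtain ⟨i, rfl⟩ := hα.2 i
    obtain ⟨j, rfl⟩ := (hβ i).2 j
    exact ⟨D.coset i j ((prodEquiv ψ).symm (g * (γ i j)⁻¹)), by rw [hF]; simp⟩

/-- Membership of `k` in `K` says that `K` and `kK` are the same coset, which an injective `F` both
preserves and reflects. -/
theorem mem_K_iff_of_map_coset {ψ : B ≃+* B} {α : D.I → D'.I}
    {β : (i : D.I) → D.J i → D'.J (α i)}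
    {γ : (i : D.I) → D.J i → Semi B} {F : D.X → D'.X} (hinj : Function.Injective F)
    (hF : ∀ i j g, F (D.coset i j g) = D'.coset (α i) (β i j) (prodEquiv ψ g * γ i j))
    (i : D.I) (j : D.J i) (k : Semi B) :
    k ∈ D.K i j ↔ (γ i j)⁻¹ * prodEquiv ψ k * γ i j ∈ D'.K (α i) (β i j) := by
  have h : D.coset i j 1 = D.coset i j k ↔ F (D.coset i j 1) = F (D.coset i j k) :=
    hinj.eq_iff.symm
  rw [hF, hF, coset_eq_coset_iff, coset_eq_coset_iff] at h
  simpa [mul_assoc] using h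

/-- An equivariant bijection permutes the orbits, compatibly with the classes of `η`. -/
theorem exists_map_coset (ha : ∀ i : Orbits B, a i ∈ i.orbit) (F : D.X ≃ D'.X) (ψ : B ≃+* B)
    (hη : ∀ x, D'.eta (F x) = ψ (D.eta x)) (hF : ∀ g x, F (g • x) = prodEquiv ψ g • F x) :
    ∃ (α : D.I → D'.I) (β : (i : D.I) → D.J i → D'.J (α i)) (γ : (i : D.I) → D.J i → Semi B),
      Function.Bijective α ∧ (∀ i, Function.Bijective (β i)) ∧
      ∀ i j g, F (D.coset i j g) = D'.coset (α i) (β i j) (prodEquiv ψ g * γ i j) := by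
  -- The index `i'` does not depend on `j`: `η` is `a i` at every base coset, so `i'` must be the
  -- orbit of `ψ (a i)`.
  have h₁ : ∀ i : D.I, ∃ i' : D'.I, ∀ j, ∃ j' γ, F (D.coset i j 1) = D'.coset i' j' γ := by
    intro i
    obtain ⟨j₀⟩ := D.J_nonempty i
    obtain ⟨i', j', γ, h⟩ := D'.exists_eq_coset (F (D.coset i j₀ 1))
    refine ⟨i', fun j => ?_⟩
    obtain ⟨k', l', δ, h'⟩ := D'.exists_eq_coset (F (D.coset i j 1))
    have e := congrArg D'.eta h
    have e' := congrArg D'.eta h'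
    rw [hη, eta_coset, eta_coset, one_smul] at e e'
    have : k' = i' := Subtype.ext (eq_of_mem_orbit ha ⟨δ⁻¹ * γ, by
      simp only [mul_smul, ← e, e', inv_smul_smul]⟩)
    subst this
    exact ⟨l', δ, h'⟩
  choose α β γ h using h₁
  have hc : ∀ i j g, F (D.coset i j g) = D'.coset (α i) (β i j) (prodEquiv ψ g * γ i j) :=
    fun i j g => by
      rw [← smul_coset, ← h, ← hF, smul_coset, mul_one]
  -- `F` reflects lying in the same `G`-orbit.
  have hinj : ∀ {i i' j j'}, (∃ g, D'.coset (α i) (β i j) g = D'.coset (α i') (β i' j') 1) →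
      ∃ g, D.coset i j g = D.coset i' j' 1 := by
    rintro i i' j j' ⟨g, hg⟩
    refine ⟨(prodEquiv ψ).symm (γ i' j' * g * (γ i j)⁻¹), F.injective ?_⟩
    rw [hc, hc, MulEquiv.apply_symm_apply, inv_mul_cancel_right, ← smul_coset, hg, smul_coset,
      map_one, one_mul, mul_one]
  have hαinj : Function.Injective α := by
    intro i i' e
    obtain ⟨j⟩ := D.J_nonempty i
    obtain ⟨j'⟩ := D.J_nonempty i'
    have e₁ := congrArg D'.eta (h i j)
    have e₂ := congrArg D'.eta (h i' j')
    rw [hη, eta_coset, eta_coset, one_smul] at e₁ e₂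
    -- Both `ψ (a i)` and `ψ (a i')` lie in the orbit of `a (α i)`; the element of `G` relating them
    -- is pulled back along `ψ × ψ`.
    refine Subtype.ext (eq_of_mem_orbit ha
      ⟨(prodEquiv ψ).symm (γ i j * (γ i' j')⁻¹), ψ.injective ?_⟩)
    change ψ (_ • a i') = _
    rw [map_smul_eq_prodEquiv_smul, MulEquiv.apply_symm_apply, e₁, e₂, mul_smul,
      inv_smul_smul, e]
  refine ⟨α, β, γ, ⟨hαinj, fun i' => ?_⟩, fun i => ⟨fun j j' e => ?_, fun j' => ?_⟩, hc⟩
  · obtain ⟨j'⟩ := D'.J_nonempty i'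
    obtain ⟨i, j, g, hg⟩ := D.exists_eq_coset (F.symm (D'.coset i' j' 1))
    rw [Equiv.symm_apply_eq, hc] at hg
    exact ⟨i, (congrArg Sigma.fst hg).symm⟩
  · obtain ⟨g, hg⟩ := hinj (i := i) (i' := i) (j := j) (j' := j') ⟨1, by rw [e]⟩
    exact D.eq_of_coset_eq_coset hg
  · obtain ⟨i₁, j, g, hg⟩ := D.exists_eq_coset (F.symm (D'.coset (α i) j' 1))
    rw [Equiv.symm_apply_eq, hc] at hg
    obtain rfl := hαinj (congrArg Sigma.fst hg)
    exact ⟨j, (D'.eq_of_coset_eq_coset hg).symm⟩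

end SolutionData

end SkewLeftBrace

theorem mainTheorem2 {B : Type u} [SkewLeftBrace B]
    (a : SkewLeftBrace.Orbits B → B)
    (ha : ∀ i : SkewLeftBrace.Orbits B, a i ∈ i.orbit)
    (D : SkewLeftBrace.SolutionData.{u, v} B a) (D' : SkewLeftBrace.SolutionData.{u, w} B a) :
    D.solution.Isomorphic D'.solution ↔
      ∃ (ψ : B ≃+* B) (α : D.I → D'.I) (β : (i : D.I) → D.J i → D'.J (α i))
        (y z : (i : D.I) → D.J i → B),
        Function.Bijective α ∧ (∀ i, Function.Bijective (β i)) ∧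
        ∀ (i : D.I) (j : D.J i),
          ψ (a i) = SkewLeftBrace.Theta (SkewLeftBrace.pair (y i j) (z i j)) (a (α i)) ∧
          SkewLeftBrace.prodMap ψ '' (D.K i j : Set (SkewLeftBrace.Semi B)) =
            (fun l => SkewLeftBrace.pair (y i j) (z i j) * l *
              (SkewLeftBrace.pair (y i j) (z i j))⁻¹) ''
              (D'.K (α i) (β i j) : Set (SkewLeftBrace.Semi B)) := by
  open SkewLeftBrace SkewLeftBrace.SolutionData in
  constructor
  · rintro ⟨F, hbij, hF⟩
    obtain ⟨ψ, hη, hs⟩ := exists_ringEquiv ha (Equiv.ofBijective F hbij) hF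
    obtain ⟨α, β, γ, hα, hβ, hc⟩ := exists_map_coset ha _ ψ hη hs
    refine ⟨ψ, α, β, fun i j => (γ i j).left.toAdd, fun i j => (γ i j).right, hα, hβ,
      fun i j => ⟨?_, (image_prodMap_eq_conj_iff ψ (γ i j) _ _).mpr
        (mem_K_iff_of_map_coset hbij.injective hc i j)⟩⟩
    -- `F` sends the base coset to `γL`, so `η' ∘ F = ψ ∘ η` there is the required formula for `ψ (a
    -- i)`.
    have e := hη (D.coset i j 1)
    rw [hc, eta_coset, eta_coset, one_smul, map_one, one_mul] at e
    exact e.symm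
  · rintro ⟨ψ, α, β, y, z, hα, hβ, h⟩
    have hK := fun i j => (image_prodMap_eq_conj_iff ψ _ _ _).mp (h i j).2
    -- On each orbit this is `gK ↦ (ψ × ψ)(g)γL` with `γ = (y, z)`, well defined because `γ⁻¹ (ψ ×
    -- ψ)(K) γ ⊆ L`.
    let F : D.X → D'.X := fun x => ⟨α x.1, β x.1 x.2.1,
      Quotient.map' (fun g => prodEquiv ψ g * pair (y x.1 x.2.1) (z x.1 x.2.1)) (fun g g' hg => by
        rw [QuotientGroup.leftRel_apply] at hg ⊢
        rw [hK, map_mul, map_inv] at hg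
        simpa [mul_assoc] using hg) x.2.2⟩
    have hF : ∀ i j g, F (D.coset i j g) =
        D'.coset (α i) (β i j) (prodEquiv ψ g * pair (y i j) (z i j)) := fun i j g => rfl
    refine isomorphic_of_equivariant F (map_coset_bijective hF hα hβ hK) ψ (fun x => ?_)
      fun g x => ?_
    · obtain ⟨i, j, g, rfl⟩ := D.exists_eq_coset x
      rw [hF, eta_coset, eta_coset, map_smul_eq_prodEquiv_smul, (h i j).1, mul_smul]
      rfl
    · obtain ⟨i, j, k, rfl⟩ := D.exists_eq_coset x
      rw [smul_coset, hF, hF, smul_coset, map_mul, mul_assoc]
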